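/- **Setting.** A partition is a weakly decreasing finite sequence of positive integers, with parts beyond its length read as $0$; for partitions $\lambda,\mu$ of the same number, $\mu\le\lambda$ in dominance order means $\mu_1+\cdots+\mu_k\le\lambda_1+\cdots+\lambda_k$ for all $k\ge1$. Let $\Lambda_{\mathbb Q}$ be the space of symmetric functions over $\mathbb Q$ in $x_1,x_2,\dots$, with its bases of monomial symmetric functions $m_\lambda$ and of Schur functions $s_\lambda=\sum_\mu K_{\lambda\mu}m_\mu$, where $K_{\lambda\mu}$ is the number of semistandard Young tableaux of shape $\lambda$ and type $\mu$; for a basis $(b_\lambda)$ write $[b_\lambda]f$ for the coefficient of $b_\lambda$ in $f$. A symmetric function $f$ is *Schur positive* if $[s_\lambda]f\ge 0$ for every partition $\lambda$, and *strongly nice* if $[m_\mu]f\ge[m_\lambda]f$ whenever $\mu\le\lambda$ in dominance order. A finite graph $G$ is called Schur positive, respectively strongly nice, if its chromatic symmetric function $X_G=\sum_\kappa\prod_{v\in V(G)}x_{\kappa(v)}$ is, where $\kappa$ ranges over all proper colorings $\kappa:V(G)\to\{1,2,\dots\}$. The squid graph $Sq(2n-1;1^n)$ is obtained from a cycle of length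 $2n-1$ by attaching $n$ leaves to one of its vertices. **Theorem.** Let $n\ge 3$ and $X=X_{Sq(2n-1;1^n)}$. Then $Sq(2n-1;1^n)$ is not strongly nice. Explicitly, $$[m_{(n,n,n-1)}]X=2(n-1)\binom{2n-2}{n-1}\;<\;4(n-1)\binom{2n-2}{n}=[m_{(n+1,n-1,n-1)}]X .$$ Moreover, $Sq(2n-1;1^n)$ is not Schur positive. -/

import Mathlib

namespace SymFun

/-! ### Symmetric functions

The indeterminates `x₁, x₂, …` are indexed by `ℕ` (so `x₁` has index `0`), and monomials by
exponent vectors `ℕ →₀ ℕ`. Partitions are Young diagrams: `lam.rowLen i` is the `(i+1)`-st part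
of `lam`, which is `0` beyond the length, and `lam.card` is the number partitioned. -/

/-- The space `Λ_ℚ(x)` of symmetric functions: formal power series in countably many indeterminates
over `ℚ` which have bounded degree and are invariant under all permutations of the
indeterminates. -/
def Lambda : Submodule ℚ (MvPowerSeries ℕ ℚ) where
  carrier := {f | (∃ N : ℕ, ∀ a : ℕ →₀ ℕ, MvPowerSeries.coeff a f ≠ 0 → a.degree ≤ N) ∧
    ∀ (w : Equiv.Perm ℕ) (a : ℕ →₀ ℕ),
      MvPowerSeries.coeff (a.mapDomain w) f = MvPowerSeries.coeff a f}
  zero_mem' := ⟨⟨0, fun a h => by simp at h⟩, fun w a => by simp⟩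
  add_mem' := by
    rintro f g ⟨⟨N, hN⟩, hf⟩ ⟨⟨M, hM⟩, hg⟩
    refine ⟨⟨max N M, fun a h => ?_⟩, fun w a => by simp [hf, hg]⟩
    by_cases h1 : MvPowerSeries.coeff a f = 0
    · exact le_max_of_le_right (hM a fun h2 => h (by simp [h1, h2]))
    · exact le_max_of_le_left (hN a h1)
  smul_mem' := by
    rintro c f ⟨⟨N, hN⟩, hf⟩
    refine ⟨⟨N, fun a h => hN a fun h1 => h (by simp [h1])⟩, fun w a => by simp [hf]⟩

/-- The exponent vector `(lam₁, …, lam_ℓ, 0, 0, …)`. -/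
noncomputable def expo (lam : YoungDiagram) : ℕ →₀ ℕ :=
  Finsupp.onFinset (Finset.range (lam.colLen 0)) lam.rowLen fun i hi => by
    rw [Finset.mem_range, ← YoungDiagram.mem_iff_lt_colLen, YoungDiagram.mem_iff_lt_rowLen]
    omega

@[simp] theorem expo_apply (lam : YoungDiagram) (i : ℕ) : expo lam i = lam.rowLen i := rfl

theorem sum_rowLen (lam : YoungDiagram) {k : ℕ} :
    ∑ i ∈ Finset.range k, lam.rowLen i = (lam.cells.filter fun c => c.1 < k).card := by
  rw [Finset.card_eq_sum_card_fiberwise (f := Prod.fst) (t := Finset.range k)]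
  · refine Finset.sum_congr rfl fun i hi => ?_
    rw [YoungDiagram.rowLen_eq_card]
    congr 1
    ext c
    simp only [YoungDiagram.mem_row_iff, Finset.mem_filter, YoungDiagram.mem_cells]
    rw [Finset.mem_range] at hi
    constructor
    · rintro ⟨h1, h2⟩; exact ⟨⟨h1, h2 ▸ hi⟩, h2⟩
    · rintro ⟨⟨h1, -⟩, h2⟩; exact ⟨h1, h2⟩
  · intro c hc
    simp at hc
    simpa using hc.2

theorem degree_expo (lam : YoungDiagram) : (expo lam).degree = lam.card := by
  have h : (expo lam).degree = ∑ i ∈ Finset.range (lam.colLen 0), lam.rowLen i := by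
    rw [Finsupp.degree_apply]
    exact Finset.sum_subset Finsupp.support_onFinset_subset
      fun i _ hi => by simpa using hi
  rw [h, sum_rowLen, YoungDiagram.card]
  congr 1
  rw [Finset.filter_true_of_mem]
  intro c hc
  rw [← YoungDiagram.mem_iff_lt_colLen]
  exact lam.up_left_mem le_rfl (Nat.zero_le _) ((YoungDiagram.mem_cells (c.1, c.2)).1 hc)

theorem degree_mapDomain (w : Equiv.Perm ℕ) (a : ℕ →₀ ℕ) :
    (a.mapDomain w).degree = a.degree := by
  rw [← Finsupp.equivMapDomain_eq_mapDomain, Finsupp.degree_apply, Finsupp.degree_apply]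
  exact (Finset.sum_bij (fun i _ => w i) (by simp) (by simp)
    (fun b hb => ⟨w.symm b, by simpa using hb, by simp⟩) (by simp)).symm

theorem finite_card_le (N : ℕ) : {lam : YoungDiagram | lam.card ≤ N}.Finite := by
  refine Set.Finite.of_finite_image (f := YoungDiagram.cells)
    (Set.Finite.subset (Finset.finite_toSet (Finset.range N ×ˢ Finset.range N).powerset) ?_) ?_
  · rintro _ ⟨lam, hlam, rfl⟩
    simp only [Set.mem_ofPred_eq] at hlam
    simp only [Finset.coe_powerset, Set.mem_preimage, Set.mem_powerset_iff, Finset.coe_subset]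
    rintro ⟨i, j⟩ hc
    rw [YoungDiagram.mem_cells] at hc
    have h1 : i < lam.colLen 0 := by
      rw [← YoungDiagram.mem_iff_lt_colLen]; exact lam.up_left_mem le_rfl (Nat.zero_le _) hc
    have h2 : j < lam.rowLen 0 := by
      rw [← YoungDiagram.mem_iff_lt_rowLen]; exact lam.up_left_mem (Nat.zero_le _) le_rfl hc
    have h3 : lam.colLen 0 ≤ lam.card := by
      rw [YoungDiagram.colLen_eq_card]; exact Finset.card_le_card (Finset.filter_subset _ _)
    have h4 : lam.rowLen 0 ≤ lam.card := by
      rw [YoungDiagram.rowLen_eq_card]; exact Finset.card_le_card (Finset.filter_subset _ _)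
    simp only [Finset.mem_product, Finset.mem_range]
    omega
  · intro a _ b _ h
    exact YoungDiagram.ext h

theorem eq_of_rowLen {lam mu : YoungDiagram} (h : ∀ i, lam.rowLen i = mu.rowLen i) :
    lam = mu := by
  ext ⟨i, j⟩
  simp only [YoungDiagram.mem_cells, YoungDiagram.mem_iff_lt_rowLen, h]

theorem eq_of_expo_perm {lam mu : YoungDiagram} (w : Equiv.Perm ℕ)
    (h : expo lam = (expo mu).mapDomain w) : lam = mu := by
  have h1 : ∀ i, lam.rowLen (w i) = mu.rowLen i := fun i => by
    have := DFunLike.congr_fun h (w i)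
    rwa [Finsupp.mapDomain_apply w.injective] at this
  have h2 : ∀ j, lam.colLen j = mu.colLen j := by
    intro j
    rw [← Finset.card_range (lam.colLen j), ← Finset.card_range (mu.colLen j)]
    refine (Finset.card_bij (fun i _ => w i) ?_ (by simp) ?_).symm
    · intro i hi
      simp only [Finset.mem_range, ← YoungDiagram.mem_iff_lt_colLen,
        YoungDiagram.mem_iff_lt_rowLen, h1] at hi ⊢
      exact hi
    · intro b hb
      refine ⟨w.symm b, ?_, by simp⟩
      simp only [Finset.mem_range, ← YoungDiagram.mem_iff_lt_colLen,
        YoungDiagram.mem_iff_lt_rowLen, ← h1, Equiv.apply_symm_apply] at hb ⊢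
      exact hb
  ext ⟨i, j⟩
  simp only [YoungDiagram.mem_cells, YoungDiagram.mem_iff_lt_colLen, h2]

/-- Every exponent vector is a rearrangement of a unique partition (see `eq_of_expo_perm`). -/
theorem exists_expo_perm (a : ℕ →₀ ℕ) :
    ∃ (lam : YoungDiagram) (w : Equiv.Perm ℕ), a = (expo lam).mapDomain w := by
  obtain ⟨N, hN⟩ : ∃ N, ∀ i, a i ≠ 0 → i < N :=
    ⟨a.support.sup id + 1, fun i hi => Nat.lt_succ_of_le
      (Finset.le_sup (f := id) (Finsupp.mem_support_iff.2 hi))⟩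
  let s : Equiv.Perm (Fin N) := Tuple.sort fun i : Fin N => OrderDual.toDual (a i)
  have hs : Antitone fun i : Fin N => a (s i) := fun i j hij =>
    Tuple.monotone_sort (fun i : Fin N => OrderDual.toDual (a i)) hij
  let w : Equiv.Perm ℕ := s.extendDomain (Fin.equivSubtype (n := N))
  have hw : ∀ i (hi : i < N), w i = s ⟨i, hi⟩ := fun i hi => by
    have := Equiv.Perm.extendDomain_apply_image s (Fin.equivSubtype (n := N)) ⟨i, hi⟩
    simpa using this
  have hw' : ∀ i, ¬ i < N → w i = i := fun i hi =>
    Equiv.Perm.extendDomain_apply_not_subtype s (Fin.equivSubtype (n := N)) hi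
  have hz : ∀ i, ¬ i < N → a i = 0 := fun i hi => by_contra fun h => hi (hN i h)
  have hanti : Antitone fun i => a (w i) := by
    intro i j hij
    show a (w j) ≤ a (w i)
    by_cases hj : j < N
    · rw [hw j hj, hw i (by omega)]
      exact hs (Fin.mk_le_mk.2 hij)
    · rw [hw' j hj, hz j hj]; exact Nat.zero_le _
  let lam : YoungDiagram :=
    { cells := (Finset.range N).biUnion fun i => {i} ×ˢ Finset.range (a (w i))
      isLowerSet := by
        rintro ⟨i, j⟩ ⟨i', j'⟩ ⟨h1, h2⟩ h
        simp only [Finset.coe_biUnion, Set.mem_iUnion, Finset.coe_product, Set.mem_prod,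
          Finset.mem_coe, Finset.mem_range, Finset.mem_singleton] at h ⊢
        obtain ⟨k, hk, rfl, h3⟩ := h
        simp only at h1 h2
        exact ⟨i', by omega, rfl, lt_of_le_of_lt h2 (lt_of_lt_of_le h3 (hanti h1))⟩ }
  have hmem : ∀ i j, (i, j) ∈ lam ↔ j < a (w i) := by
    intro i j
    rw [← YoungDiagram.mem_cells]
    simp only [lam, Finset.mem_biUnion, Finset.mem_product, Finset.mem_range,
      Finset.mem_singleton]
    constructor
    · rintro ⟨k, hk, rfl, h⟩; exact h
    · intro h
      refine ⟨i, ?_, rfl, h⟩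
      by_contra hi
      rw [hw' i hi, hz i hi] at h
      omega
  have hrow : ∀ i, lam.rowLen i = a (w i) := fun i => by
    refine eq_of_forall_lt_iff fun j => ?_
    rw [← YoungDiagram.mem_iff_lt_rowLen, hmem]
  refine ⟨lam, w, ?_⟩
  ext i
  obtain ⟨k, rfl⟩ := w.surjective i
  rw [Finsupp.mapDomain_apply w.injective, expo_apply, hrow]

open Classical in
/-- The monomial symmetric function `m_lam`: the sum of all monomials `x^a`, where `a` ranges over
the distinct permutations of `(lam₁, …, lam_ℓ, 0, 0, …)`. -/
noncomputable def monomialSymm (lam : YoungDiagram) : Lambda :=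
  ⟨fun a => if ∃ w : Equiv.Perm ℕ, a = (expo lam).mapDomain w then 1 else 0, by
    refine ⟨⟨lam.card, fun a ha => ?_⟩, fun w a => ?_⟩
    · have h : ∃ w : Equiv.Perm ℕ, a = (expo lam).mapDomain w := by
        by_contra h
        exact ha (if_neg h)
      obtain ⟨w, rfl⟩ := h
      rw [degree_mapDomain, degree_expo]
    · refine if_congr ⟨?_, ?_⟩ rfl rfl
      · rintro ⟨v, hv⟩
        refine ⟨v.trans w.symm, ?_⟩
        have := congrArg (Finsupp.mapDomain w.symm) hv
        rw [← Finsupp.mapDomain_comp, ← Finsupp.mapDomain_comp] at this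
        simpa [Equiv.coe_trans] using this
      · rintro ⟨v, rfl⟩
        exact ⟨v.trans w, by rw [← Finsupp.mapDomain_comp]; rfl⟩⟩

open Classical in
theorem coeff_monomialSymm (lam : YoungDiagram) (a : ℕ →₀ ℕ) :
    MvPowerSeries.coeff a (monomialSymm lam : MvPowerSeries ℕ ℚ) =
      if ∃ w : Equiv.Perm ℕ, a = (expo lam).mapDomain w then 1 else 0 := rfl

open Classical in
theorem coeff_expo_monomialSymm (lam mu : YoungDiagram) :
    MvPowerSeries.coeff (expo mu) (monomialSymm lam : MvPowerSeries ℕ ℚ) =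
      if mu = lam then 1 else 0 := by
  rw [coeff_monomialSymm]
  refine if_congr ⟨fun ⟨w, hw⟩ => eq_of_expo_perm w hw, ?_⟩ rfl rfl
  rintro rfl
  exact ⟨1, by simp [Finsupp.mapDomain_id]⟩

theorem Lambda_ext {f g : Lambda}
    (h : ∀ lam, MvPowerSeries.coeff (expo lam) (f : MvPowerSeries ℕ ℚ) =
      MvPowerSeries.coeff (expo lam) (g : MvPowerSeries ℕ ℚ)) : f = g := by
  apply Subtype.ext
  ext a
  obtain ⟨lam, w, rfl⟩ := exists_expo_perm a
  rw [f.2.2, g.2.2, h]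

theorem linearIndependent_monomialSymm : LinearIndependent ℚ monomialSymm := by
  classical
  rw [linearIndependent_iff]
  intro c hc
  ext mu
  have h := congrArg
    (fun f : Lambda => MvPowerSeries.coeff (expo mu) (f : MvPowerSeries ℕ ℚ)) hc
  simpa [Finsupp.linearCombination_apply, Finsupp.sum, coeff_expo_monomialSymm] using h

theorem span_monomialSymm : ⊤ ≤ Submodule.span ℚ (Set.range monomialSymm) := by
  classical
  rintro f -
  obtain ⟨N, hN⟩ := f.2.1
  have hf : f = ∑ lam ∈ (finite_card_le N).toFinset,
      MvPowerSeries.coeff (expo lam) (f : MvPowerSeries ℕ ℚ) • monomialSymm lam := by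
    apply Lambda_ext
    intro mu
    have : MvPowerSeries.coeff (expo mu) (f : MvPowerSeries ℕ ℚ) ≠ 0 → mu.card ≤ N :=
      fun h => degree_expo mu ▸ hN _ h
    simp [coeff_expo_monomialSymm]
    intro h
    by_contra h1
    exact absurd (this h1) (by omega)
  rw [hf]
  exact Submodule.sum_mem _ fun lam _ =>
    Submodule.smul_mem _ _ (Submodule.subset_span ⟨lam, rfl⟩)

/-- The basis `(m_lam)` of the space of symmetric functions. -/
noncomputable def mBasis : Module.Basis YoungDiagram ℚ Lambda :=
  Module.Basis.mk linearIndependent_monomialSymm span_monomialSymm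

/-- The type (content) condition: for all `k`, the tableau `T` has exactly `mu_k` entries equal to
`k`. (Entries of semistandard tableaux in Mathlib start at `0`, as does `rowLen`.) -/
def HasType {lam : YoungDiagram} (T : SemistandardYoungTableau lam) (mu : YoungDiagram) : Prop :=
  ∀ k : ℕ, (lam.cells.filter fun c => T c.1 c.2 = k).card = mu.rowLen k

/-- The Kostka number `K_{lam,mu}`: the number of semistandard Young tableaux of shape `lam` and
type `mu`. -/
noncomputable def kostka (lam mu : YoungDiagram) : ℕ :=
  Nat.card {T : SemistandardYoungTableau lam // HasType T mu}

/-- The finite set of all partitions of `d`. -/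
noncomputable def partitionsOf (d : ℕ) : Finset YoungDiagram :=
  (finite_card_le d).toFinset.filter fun lam => lam.card = d

@[simp] theorem mem_partitionsOf {d : ℕ} {lam : YoungDiagram} :
    lam ∈ partitionsOf d ↔ lam.card = d := by
  simpa [partitionsOf] using fun h : lam.card = d => h.le

/-- The Schur function `s_lam = ∑_mu K_{lam,mu} m_mu`; only the partitions `mu` of the same number
as `lam` contribute. -/
noncomputable def schur (lam : YoungDiagram) : Lambda :=
  ∑ mu ∈ partitionsOf lam.card, (kostka lam mu : ℚ) • monomialSymm mu

/-- Dominance order: `DomLE mu lam` says that `mu` and `lam` are partitions of the same number and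
`mu₁ + ⋯ + mu_k ≤ lam₁ + ⋯ + lam_k` for all `k`. -/
def DomLE (mu lam : YoungDiagram) : Prop :=
  mu.card = lam.card ∧
    ∀ k : ℕ, ∑ i ∈ Finset.range k, mu.rowLen i ≤ ∑ i ∈ Finset.range k, lam.rowLen i

theorem sum_rowLen_eq_of_hasType {lam mu : YoungDiagram} {T : SemistandardYoungTableau lam}
    (h : HasType T mu) (k : ℕ) :
    ∑ i ∈ Finset.range k, mu.rowLen i = (lam.cells.filter fun c => T c.1 c.2 < k).card := by
  rw [Finset.card_eq_sum_card_fiberwise (f := fun c => T c.1 c.2) (t := Finset.range k)]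
  · refine Finset.sum_congr rfl fun i hi => ?_
    rw [← h i]
    congr 1
    ext c
    simp only [Finset.mem_filter]
    rw [Finset.mem_range] at hi
    constructor
    · rintro ⟨h1, h2⟩; exact ⟨⟨h1, h2 ▸ hi⟩, h2⟩
    · rintro ⟨⟨h1, -⟩, h2⟩; exact ⟨h1, h2⟩
  · intro c hc
    simp at hc
    simpa using hc.2

theorem sum_rowLen_le_of_hasType {lam mu : YoungDiagram} {T : SemistandardYoungTableau lam}
    (h : HasType T mu) (k : ℕ) :
    ∑ i ∈ Finset.range k, mu.rowLen i ≤ ∑ i ∈ Finset.range k, lam.rowLen i := by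
  rw [sum_rowLen_eq_of_hasType h, sum_rowLen]
  refine Finset.card_le_card fun c hc => ?_
  simp only [Finset.mem_filter] at hc ⊢
  refine ⟨hc.1, lt_of_le_of_lt ?_ hc.2⟩
  have key : ∀ i j, (i, j) ∈ lam → i ≤ T i j := by
    intro i j
    induction i with
    | zero => intro _; exact Nat.zero_le _
    | succ i ih =>
      intro hm
      have h1 := ih (lam.up_left_mem (Nat.le_succ i) le_rfl hm)
      have h2 := T.col_strict (show i < i + 1 by omega) hm
      omega
  exact key c.1 c.2 ((YoungDiagram.mem_cells (c.1, c.2)).1 hc.1)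

theorem kostka_ne_zero {lam mu : YoungDiagram} (h : kostka lam mu ≠ 0) (k : ℕ) :
    ∑ i ∈ Finset.range k, mu.rowLen i ≤ ∑ i ∈ Finset.range k, lam.rowLen i := by
  have : Nonempty {T : SemistandardYoungTableau lam // HasType T mu} := by
    by_contra h1
    rw [not_nonempty_iff] at h1
    exact h Nat.card_of_isEmpty
  obtain ⟨T, hT⟩ := this
  exact sum_rowLen_le_of_hasType hT k

theorem finite_tableaux (lam mu : YoungDiagram) :
    Finite {T : SemistandardYoungTableau lam // HasType T mu} := by
  have hb : ∀ T : {T : SemistandardYoungTableau lam // HasType T mu}, ∀ c : lam.cells,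
      T.1 c.1.1 c.1.2 < mu.colLen 0 := by
    rintro ⟨T, hT⟩ ⟨c, hc⟩
    rw [← YoungDiagram.mem_iff_lt_colLen, YoungDiagram.mem_iff_lt_rowLen, ← hT,
      Finset.card_pos]
    exact ⟨c, by simpa using hc⟩
  refine Finite.of_injective
    (fun T (c : lam.cells) => (⟨T.1 c.1.1 c.1.2, hb T c⟩ : Fin (mu.colLen 0))) ?_
  rintro ⟨T, hT⟩ ⟨T', hT'⟩ h
  apply Subtype.ext
  refine SemistandardYoungTableau.ext fun i j => ?_
  by_cases hc : (i, j) ∈ lam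
  · have := congrFun h ⟨(i, j), (YoungDiagram.mem_cells (i, j)).2 hc⟩
    simpa using this
  · show T i j = T' i j
    rw [T.zeros hc, T'.zeros hc]

theorem kostka_self_ne_zero (lam : YoungDiagram) : kostka lam lam ≠ 0 := by
  have := finite_tableaux lam lam
  have : Nonempty {T : SemistandardYoungTableau lam // HasType T lam} := by
    refine ⟨SemistandardYoungTableau.highestWeight lam, fun k => ?_⟩
    rw [YoungDiagram.rowLen_eq_card]
    congr 1
    ext c
    rw [Finset.mem_filter, YoungDiagram.mem_cells, YoungDiagram.mem_row_iff]
    refine and_congr_right fun h => ?_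
    rw [SemistandardYoungTableau.highestWeight_apply, if_pos h]
  exact Nat.card_pos.ne'

/-- An auxiliary statistic that is strictly monotone for the dominance order. -/
def domRank (lam : YoungDiagram) : ℕ :=
  ∑ k ∈ Finset.range (lam.card + 1), ∑ i ∈ Finset.range k, lam.rowLen i

theorem domRank_lt {lam mu : YoungDiagram} (h : DomLE mu lam) (hne : mu ≠ lam) :
    domRank mu < domRank lam := by
  unfold domRank
  rw [h.1]
  refine Finset.sum_lt_sum (fun k _ => h.2 k) ?_
  by_contra hcon
  push Not at hcon
  have heq : ∀ k ≤ lam.card, ∑ i ∈ Finset.range k, mu.rowLen i =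
      ∑ i ∈ Finset.range k, lam.rowLen i := fun k hk =>
    le_antisymm (h.2 k) (hcon k (Finset.mem_range.2 (Nat.lt_succ_of_le hk)))
  refine hne (eq_of_rowLen fun i => ?_)
  by_cases hi : i < lam.card
  · have h1 := heq (i + 1) hi
    rw [Finset.sum_range_succ, Finset.sum_range_succ, heq i hi.le] at h1
    omega
  · have hz : ∀ nu : YoungDiagram, nu.card = lam.card → nu.rowLen i = 0 := by
      intro nu hnu
      by_contra h0
      have hm : (i, 0) ∈ nu := YoungDiagram.mem_iff_lt_rowLen.2 (Nat.pos_of_ne_zero h0)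
      rw [YoungDiagram.mem_iff_lt_colLen] at hm
      have : nu.colLen 0 ≤ nu.card := by
        rw [YoungDiagram.colLen_eq_card]; exact Finset.card_le_card (Finset.filter_subset _ _)
      omega
    rw [hz mu h.1, hz lam rfl]

theorem coeff_expo_schur (lam mu : YoungDiagram) (h : mu.card = lam.card) :
    MvPowerSeries.coeff (expo mu) (schur lam : MvPowerSeries ℕ ℚ) = kostka lam mu := by
  classical
  simp [schur, coeff_expo_monomialSymm, h]

theorem coeff_expo_schur_of_ne (lam mu : YoungDiagram) (h : mu.card ≠ lam.card) :
    MvPowerSeries.coeff (expo mu) (schur lam : MvPowerSeries ℕ ℚ) = 0 := by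
  classical
  simp [schur, coeff_expo_monomialSymm, h]

theorem linearIndependent_schur : LinearIndependent ℚ schur := by
  classical
  rw [linearIndependent_iff]
  intro c hc
  by_contra hne
  obtain ⟨lam, hlam, hmax⟩ := Finset.exists_max_image c.support domRank
    (Finsupp.support_nonempty_iff.2 hne)
  have h := congrArg
    (fun f : Lambda => MvPowerSeries.coeff (expo lam) (f : MvPowerSeries ℕ ℚ)) hc
  simp only [Finsupp.linearCombination_apply, Finsupp.sum, Submodule.coe_sum,
    Submodule.coe_smul, map_sum, MvPowerSeries.coeff_smul, Submodule.coe_zero, map_zero] at h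
  rw [Finset.sum_eq_single lam] at h
  · rw [coeff_expo_schur lam lam rfl, mul_eq_zero] at h
    rcases h with h | h
    · exact (Finsupp.mem_support_iff.1 hlam) h
    · exact kostka_self_ne_zero lam (by exact_mod_cast h)
  · intro nu hnu hnl
    by_cases hcard : lam.card = nu.card
    · rw [coeff_expo_schur nu lam hcard]
      by_cases hK : kostka nu lam = 0
      · simp [hK]
      · have := domRank_lt ⟨hcard, kostka_ne_zero hK⟩ hnl.symm
        have := hmax nu hnu
        omega
    · rw [coeff_expo_schur_of_ne nu lam hcard, mul_zero]
  · intro h1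
    exact absurd hlam h1

theorem span_schur : ⊤ ≤ Submodule.span ℚ (Set.range schur) := by
  classical
  refine le_trans span_monomialSymm (Submodule.span_le.2 ?_)
  rintro _ ⟨lam, rfl⟩
  rw [SetLike.mem_coe]
  induction hr : domRank lam using Nat.strong_induction_on generalizing lam with
  | _ r ih =>
    have hK : (kostka lam lam : ℚ) ≠ 0 := by exact_mod_cast kostka_self_ne_zero lam
    have hs : schur lam = (kostka lam lam : ℚ) • monomialSymm lam +
        ∑ mu ∈ (partitionsOf lam.card).erase lam, (kostka lam mu : ℚ) • monomialSymm mu := by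
      rw [schur, Finset.add_sum_erase _ (fun mu => (kostka lam mu : ℚ) • monomialSymm mu)
        (mem_partitionsOf.2 rfl)]
    have hm : monomialSymm lam = (kostka lam lam : ℚ)⁻¹ • (schur lam -
        ∑ mu ∈ (partitionsOf lam.card).erase lam, (kostka lam mu : ℚ) • monomialSymm mu) := by
      rw [hs, add_sub_cancel_right, smul_smul, inv_mul_cancel₀ hK, one_smul]
    rw [hm]
    refine Submodule.smul_mem _ _ (Submodule.sub_mem _ (Submodule.subset_span ⟨lam, rfl⟩)
      (Submodule.sum_mem _ fun mu hmu => ?_))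
    rw [Finset.mem_erase, mem_partitionsOf] at hmu
    by_cases h0 : kostka lam mu = 0
    · simp [h0]
    · exact Submodule.smul_mem _ _
        (ih _ (hr ▸ domRank_lt ⟨hmu.2, kostka_ne_zero h0⟩ hmu.1) mu rfl)

/-- The basis `(s_lam)` of the space of symmetric functions. -/
noncomputable def sBasis : Module.Basis YoungDiagram ℚ Lambda :=
  Module.Basis.mk linearIndependent_schur span_schur

/-- `[m_lam] f`, the coefficient of `m_lam` in `f`. -/
noncomputable def mCoeff (lam : YoungDiagram) (f : Lambda) : ℚ := mBasis.repr f lam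

theorem mCoeff_eq_coeff (lam : YoungDiagram) (f : Lambda) :
    mCoeff lam f = MvPowerSeries.coeff (expo lam) (f : MvPowerSeries ℕ ℚ) := by
  classical
  have h := congrArg
    (fun g : Lambda => MvPowerSeries.coeff (expo lam) (g : MvPowerSeries ℕ ℚ))
    (mBasis.linearCombination_repr f)
  simp only [Finsupp.linearCombination_apply, Finsupp.sum, Submodule.coe_sum,
    Submodule.coe_smul, map_sum, MvPowerSeries.coeff_smul, mBasis, Module.Basis.mk_apply,
    coeff_expo_monomialSymm, mul_ite, mul_one, mul_zero, Finset.sum_ite_eq] at h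
  rw [← h]
  split_ifs with h1
  · rfl
  · exact Finsupp.notMem_support_iff.1 h1

/-- `[s_lam] f`, the coefficient of `s_lam` in `f`. -/
noncomputable def sCoeff (lam : YoungDiagram) (f : Lambda) : ℚ := sBasis.repr f lam

/-- A symmetric function is Schur positive if all its coefficients in the Schur basis are
nonnegative. -/
def SchurPositive (f : Lambda) : Prop := ∀ lam : YoungDiagram, 0 ≤ sCoeff lam f

/-- A symmetric function `f` is strongly nice if `[m_mu] f ≥ [m_lam] f` whenever `mu ≤ lam` in
dominance order. -/
def StronglyNice (f : Lambda) : Prop :=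
  ∀ mu lam : YoungDiagram, DomLE mu lam → mCoeff lam f ≤ mCoeff mu f

/-! ### Chromatic symmetric functions -/

/-- The exponent vector of the monomial `∏ v, x_{κ(v)}`. -/
noncomputable def colorWeight {V : Type*} [Fintype V] (κ : V → ℕ) : ℕ →₀ ℕ :=
  ∑ v, Finsupp.single (κ v) 1

/-- The chromatic symmetric function `X_G = ∑_κ ∏ v, x_{κ(v)}`, over all proper colorings `κ` of
`G` by the indices of the indeterminates: the coefficient of `x^a` is the number of proper
colorings whose monomial is `x^a`. -/
noncomputable def chromaticSymm {V : Type*} [Fintype V] (G : SimpleGraph V) : Lambda :=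
  ⟨fun a => (Nat.card {κ : G.Coloring ℕ // colorWeight κ = a} : ℚ), by
    refine ⟨⟨Fintype.card V, fun a ha => ?_⟩, fun w a => ?_⟩
    · have h : Nat.card {κ : G.Coloring ℕ // colorWeight κ = a} ≠ 0 := fun h =>
        ha (Nat.cast_eq_zero.2 h)
      have : Nonempty {κ : G.Coloring ℕ // colorWeight κ = a} := by
        by_contra h1
        rw [not_nonempty_iff] at h1
        exact h Nat.card_of_isEmpty
      obtain ⟨κ, rfl⟩ := this
      simp [colorWeight]
    · have hw : ∀ (v : Equiv.Perm ℕ) (κ : V → ℕ),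
          colorWeight (v ∘ κ) = (colorWeight κ).mapDomain v := fun v κ => by
        simp [colorWeight, Finsupp.mapDomain_finsetSum]
      refine congrArg (Nat.cast (R := ℚ)) (Eq.symm ?_)
      refine Nat.card_congr
        { toFun := fun κ => ⟨SimpleGraph.Coloring.mk (w ∘ κ.1) fun h e =>
              κ.1.valid h (w.injective e), by
            have := hw w κ.1
            rw [κ.2] at this
            exact this⟩
          invFun := fun κ => ⟨SimpleGraph.Coloring.mk (w.symm ∘ κ.1) fun h e =>
              κ.1.valid h (w.symm.injective e), by
            have := hw w.symm κ.1
            rw [κ.2, ← Finsupp.mapDomain_comp, Equiv.symm_comp_self, Finsupp.mapDomain_id] at this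
            exact this⟩
          left_inv := fun κ => ?_
          right_inv := fun κ => ?_ }
      · apply Subtype.ext
        apply RelHom.ext
        intro v
        exact w.symm_apply_apply _
      · apply Subtype.ext
        apply RelHom.ext
        intro v
        exact w.apply_symm_apply _⟩

/-- The squid graph `Sq(m; 1^k)`: the cycle on the `m` vertices `inl 0, …, inl (m-1)` with `k`
leaves `inr 0, …, inr (k-1)` attached to the vertex `inl 0`. -/
def squidGraph (m k : ℕ) : SimpleGraph (Fin m ⊕ Fin k) where
  Adj
    | .inl i, .inl j => (SimpleGraph.cycleGraph m).Adj i j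
    | .inl i, .inr _ => i.val = 0
    | .inr _, .inl i => i.val = 0
    | .inr _, .inr _ => False
  symm := ⟨by
    rintro (i | i) (j | j) h
    · exact SimpleGraph.Adj.symm h
    · exact h
    · exact h
    · exact h⟩
  loopless := ⟨by
    rintro (i | i) h
    · exact SimpleGraph.irrefl _ h
    · exact h⟩

/-- The partition `(n, n, n-1)`. -/
def partA (n : ℕ) : YoungDiagram :=
  YoungDiagram.ofRowLens [n, n, n - 1] (by simp [List.sortedGE_iff_pairwise])

/-- The partition `(n+1, n-1, n-1)`. -/
def partB (n : ℕ) : YoungDiagram :=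
  YoungDiagram.ofRowLens [n + 1, n - 1, n - 1] (by
    simp [List.sortedGE_iff_pairwise]; omega)

end SymFun

namespace SymFun

/-! The color class of the attachment vertex contains no leaf, and an independent set of the cycle
of length 2n-1 has at most n-1 vertices, so this class has size at most n-1. Every nonzero part of
(n,n,n-1) and of (n+1,n-1,n-1) is at least n-1, hence in every coloring counted by either
coefficient the class is a maximum independent set of the cycle containing the attachment vertex.
There are n-1 such sets (`exists_centerClass`), and the complement of each spans a single edge, the
gap (`squidGraph_adj_cases`).

The two remaining colors must differ on the gap, which gives a factor 2, and are unconstrained on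
the other 2n-2 vertices. This is the count in `card_colorings_of_center`. For (n,n,n-1) the color of
the attachment vertex is forced and one chooses n-1 of the free vertices; for (n+1,n-1,n-1) two
colors are possible and one chooses n. Comparing the binomial coefficients gives the strict
inequality, which contradicts strong niceness because (n,n,n-1) is dominated by (n+1,n-1,n-1).

The same inequality excludes Schur positivity. The monomial coefficients of a Schur positive
function are nonnegative combinations of Kostka numbers, and `kostka_le_of_move` shows, by an
injection of tableaux, that no Kostka number decreases in passing from type (n+1,n-1,n-1) to type
(n,n,n-1). -/

/-! ### Schur positivity and Kostka numbers -/

theorem mCoeff_eq_sum_schur (mu : YoungDiagram) (f : Lambda) :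
    mCoeff mu f = (sBasis.repr f).sum fun lam c => c * mCoeff mu (schur lam) := by
  have h := congrArg (mCoeff mu) (sBasis.linearCombination_repr f)
  simpa [Finsupp.linearCombination_apply, Finsupp.sum, mCoeff, sBasis] using h.symm

/-- Compare the Schur expansions term by term, the weights being nonnegative. Equal size ensures
that a Schur function of another degree contributes zero to both sides. -/
theorem mCoeff_le_of_schurPositive {mu nu : YoungDiagram} (hcard : mu.card = nu.card)
    (hK : ∀ lam, kostka lam nu ≤ kostka lam mu) {f : Lambda} (hf : SchurPositive f) :
    mCoeff nu f ≤ mCoeff mu f := by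
  rw [mCoeff_eq_sum_schur, mCoeff_eq_sum_schur]
  refine Finset.sum_le_sum fun lam _ => mul_le_mul_of_nonneg_left ?_ (hf lam)
  rw [mCoeff_eq_coeff, mCoeff_eq_coeff]
  by_cases h : mu.card = lam.card
  · rw [coeff_expo_schur _ _ h, coeff_expo_schur _ _ (hcard ▸ h)]
    exact_mod_cast hK lam
  · rw [coeff_expo_schur_of_ne _ _ h, coeff_expo_schur_of_ne _ _ (hcard ▸ h)]

/-! ### An injection between tableaux of different types -/

theorem le_semistandard_apply {lam : YoungDiagram} (T : SemistandardYoungTableau lam) {i j : ℕ}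
    (h : (i, j) ∈ lam) : i ≤ T i j := by
  induction i with
  | zero => exact Nat.zero_le _
  | succ i ih =>
    have h1 := ih (lam.up_left_mem (Nat.le_succ i) le_rfl h)
    have h2 := T.col_strict (show i < i + 1 by omega) h
    omega

/-- The cells of the `i`-th row with entry at most `k` in a semistandard tableau form an initial
segment. -/
theorem row_entries_le_initial {lam : YoungDiagram} (T : SemistandardYoungTableau lam) (i k : ℕ) :
    ∃ r, ∀ j, ((i, j) ∈ lam ∧ T i j ≤ k) ↔ j < r := by
  classical
  have hex : ∃ r, ¬ ((i, r) ∈ lam ∧ T i r ≤ k) := by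
    refine ⟨lam.rowLen i, fun h => ?_⟩
    have := YoungDiagram.mem_iff_lt_rowLen.1 h.1
    omega
  refine ⟨Nat.find hex, fun j => ⟨fun h => ?_, fun h => not_not.1 (Nat.find_min hex h)⟩⟩
  by_contra hj
  replace hj := not_lt.1 hj
  refine Nat.find_spec hex ⟨lam.up_left_mem le_rfl hj h.1, ?_⟩
  rcases hj.eq_or_lt with e | e
  · rw [e]; exact h.2
  · exact (T.row_weak e h.1).trans h.2

/-- Entries are at least their row index, so all zeros lie in the top row, where they form an
initial segment whose length is prescribed by the type. Membership in the shape has to be part of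
the condition because tableaux take the value 0 outside it. -/
theorem zero_entry_iff {lam mu : YoungDiagram} {T : SemistandardYoungTableau lam}
    (hT : HasType T mu) (j : ℕ) : ((0, j) ∈ lam ∧ T 0 j = 0) ↔ j < mu.rowLen 0 := by
  obtain ⟨r, hr⟩ := row_entries_le_initial T 0 0
  have h : r = mu.rowLen 0 := by
    rw [← hT 0, ← Finset.card_range r]
    refine Finset.card_bij (fun j _ => (0, j)) ?_ (by simp) ?_
    · intro j hj
      simpa using (hr j).2 (Finset.mem_range.1 hj)
    · rintro ⟨i, j⟩ h
      simp only [Finset.mem_filter, YoungDiagram.mem_cells] at h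
      obtain rfl : i = 0 := by have := le_semistandard_apply T h.1; omega
      exact ⟨j, Finset.mem_range.2 ((hr j).1 ⟨h.1, h.2.le⟩), rfl⟩
  rw [← h, ← hr, Nat.le_zero]

/-- Entries of row 1 are at least 1, so everything to the left of a 1 in this row is also a 1; this
gives `j + 1` ones. -/
theorem one_entry_lt {lam mu : YoungDiagram} {T : SemistandardYoungTableau lam}
    (hT : HasType T mu) {j : ℕ} (hj : (1, j) ∈ lam) (h1 : T 1 j = 1) : j < mu.rowLen 1 := by
  rw [← hT 1]
  have : (Finset.range (j + 1)).card ≤ (lam.cells.filter fun c => T c.1 c.2 = 1).card := by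
    refine Finset.card_le_card_of_injOn (fun j => (1, j)) ?_ (by simp [Set.InjOn])
    intro i hi
    have hij : i ≤ j := by simpa [Nat.lt_succ_iff] using hi
    have hm : (1, i) ∈ lam := lam.up_left_mem le_rfl hij hj
    have h2 := le_semistandard_apply T hm
    have h3 : T 1 i ≤ T 1 j := by
      rcases hij.eq_or_lt with e | e
      · rw [e]
      · exact T.row_weak e hj
    simp only [Finset.coe_filter, Set.mem_ofPred_eq, YoungDiagram.mem_cells]
    exact ⟨hm, by omega⟩
  simpa using this

/-- Turning the last entry `0` of a semistandard tableau into a `1`, which is possible if the `1`s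
of the second row do not reach below it. -/
def raiseLastZero {lam nu : YoungDiagram} (T : SemistandardYoungTableau lam) (hT : HasType T nu)
    {r : ℕ} (hr : nu.rowLen 0 = r + 1) (h1 : nu.rowLen 1 ≤ r) : SemistandardYoungTableau lam where
  entry i j := if i = 0 ∧ j = r then 1 else T i j
  row_weak' {i j1 j2} h hm := by
    have hz := zero_entry_iff hT
    split_ifs with e1 e2 e2
    · rfl
    · obtain ⟨rfl, rfl⟩ := e1
      have := hz j2
      rw [hr] at this
      by_contra h3
      have := this.1 ⟨hm, by omega⟩
      omega
    · obtain ⟨rfl, rfl⟩ := e2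
      have := ((hz j1).2 (by omega)).2
      omega
    · exact T.row_weak h hm
  col_strict' {i1 i2 j} h hm := by
    have hc := T.col_strict h hm
    split_ifs with e1 e2 e2
    · omega
    -- Below the raised cell only a 1 in row 1 could violate strictness, but the ones of row 1 stay
    -- in columns before `r`.
    · obtain ⟨rfl, rfl⟩ := e1
      have h2 := le_semistandard_apply T hm
      by_contra h3
      obtain rfl : i2 = 1 := by omega
      have := one_entry_lt hT hm (by omega)
      omega
    · omega
    · exact hc
  zeros' {i j} h := by
    rw [if_neg, T.zeros h]
    rintro ⟨rfl, rfl⟩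
    exact h ((zero_entry_iff hT j).2 (by omega)).1

theorem raiseLastZero_apply {lam nu : YoungDiagram} (T : SemistandardYoungTableau lam)
    (hT : HasType T nu) {r : ℕ} (hr : nu.rowLen 0 = r + 1) (h1 : nu.rowLen 1 ≤ r) (i j : ℕ) :
    raiseLastZero T hT hr h1 i j = if i = 0 ∧ j = r then 1 else T i j := rfl

/-- Raising the last zero is injective: the changed cell `(0, r)` depends only on the type `nu`, and
its old entry is known to be 0. -/
theorem kostka_le_of_move {mu nu : YoungDiagram} {r : ℕ} (hr : nu.rowLen 0 = r + 1)
    (h1 : nu.rowLen 1 ≤ r) (m0 : mu.rowLen 0 = r) (m1 : mu.rowLen 1 = nu.rowLen 1 + 1)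
    (m2 : ∀ i, 2 ≤ i → mu.rowLen i = nu.rowLen i) (lam : YoungDiagram) :
    kostka lam nu ≤ kostka lam mu := by
  have := finite_tableaux lam mu
  refine Nat.card_le_card_of_injective (fun T : {T : SemistandardYoungTableau lam // HasType T nu} =>
    (⟨raiseLastZero T.1 T.2 hr h1, fun k => ?_⟩ :
      {T : SemistandardYoungTableau lam // HasType T mu})) ?_
  · obtain ⟨T, hT⟩ := T
    obtain ⟨hm, h0⟩ := (zero_entry_iff hT r).2 (by omega)
    have hk := hT k
    rw [← YoungDiagram.mem_cells] at hm
    rcases Nat.lt_or_ge k 2 with hk2 | hk2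
    · interval_cases k
      · rw [m0]
        have : (lam.cells.filter fun c => raiseLastZero T hT hr h1 c.1 c.2 = 0) =
            (lam.cells.filter fun c => T c.1 c.2 = 0).erase (0, r) := by
          ext ⟨i, j⟩
          rw [Finset.mem_filter, raiseLastZero_apply, Finset.mem_erase, Finset.mem_filter, ne_eq,
            Prod.mk.injEq]
          by_cases e : i = 0 ∧ j = r <;> simp [e]
        rw [this, Finset.card_erase_of_mem (by simpa [h0] using hm), hk]
        omega
      · rw [m1]
        have : (lam.cells.filter fun c => raiseLastZero T hT hr h1 c.1 c.2 = 1) =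
            insert (0, r) (lam.cells.filter fun c => T c.1 c.2 = 1) := by
          ext ⟨i, j⟩
          rw [Finset.mem_filter, raiseLastZero_apply, Finset.mem_insert, Finset.mem_filter,
            Prod.mk.injEq]
          by_cases e : i = 0 ∧ j = r
          · obtain ⟨rfl, rfl⟩ := e
            simpa using hm
          · simp [e]
        rw [this, Finset.card_insert_of_notMem (by simp [h0]), hk]
    · rw [m2 k hk2, ← hk]
      congr 1
      ext ⟨i, j⟩
      rw [Finset.mem_filter, raiseLastZero_apply, Finset.mem_filter]
      split_ifs with e
      · obtain ⟨rfl, rfl⟩ := e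
        simp only [h0]; omega
      · rfl
  · rintro ⟨T, hT⟩ ⟨T', hT'⟩ h
    apply Subtype.ext
    refine SemistandardYoungTableau.ext fun i j => ?_
    have h2 := congrArg (fun S : {T : SemistandardYoungTableau lam // HasType T mu} => S.1 i j) h
    simp only [raiseLastZero_apply] at h2
    split_ifs at h2 with e
    · obtain ⟨rfl, rfl⟩ := e
      rw [((zero_entry_iff hT j).2 (by omega)).2, ((zero_entry_iff hT' j).2 (by omega)).2]
    · exact h2

/-! ### The two partitions -/

theorem rowLen_ofRowLens {w : List ℕ} (hw : w.SortedGE) (i : ℕ) :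
    (YoungDiagram.ofRowLens w hw).rowLen i = w.getD i 0 := by
  refine eq_of_forall_lt_iff fun j => ?_
  rw [← YoungDiagram.mem_iff_lt_rowLen, YoungDiagram.mem_ofRowLens]
  by_cases h : i < w.length <;> simp [h]

theorem card_eq_sum_rowLen {lam : YoungDiagram} {k : ℕ} (h : lam.rowLen k = 0) :
    lam.card = ∑ i ∈ Finset.range k, lam.rowLen i := by
  rw [sum_rowLen, YoungDiagram.card, Finset.filter_true_of_mem]
  rintro ⟨i, j⟩ hc
  by_contra hi
  have h1 : (k, j) ∈ lam :=
    lam.up_left_mem (not_lt.1 hi) le_rfl ((YoungDiagram.mem_cells (i, j)).1 hc)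
  have := YoungDiagram.mem_iff_lt_rowLen.1 h1
  omega

theorem rowLen_partA (n i : ℕ) : (partA n).rowLen i = [n, n, n - 1].getD i 0 :=
  rowLen_ofRowLens _ i

theorem rowLen_partB (n i : ℕ) : (partB n).rowLen i = [n + 1, n - 1, n - 1].getD i 0 :=
  rowLen_ofRowLens _ i

theorem domLE_partA_partB {n : ℕ} (hn : 1 ≤ n) : DomLE (partA n) (partB n) := by
  refine ⟨?_, fun k => ?_⟩
  · rw [card_eq_sum_rowLen (k := 3) (by simp [rowLen_partA]),
      card_eq_sum_rowLen (k := 3) (by simp [rowLen_partB])]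
    simp [Finset.sum_range_succ, rowLen_partA, rowLen_partB]
    omega
  · induction k using Nat.strong_induction_on with
    | _ k ih =>
      match k with
      | 0 => simp
      | 1 => simp [rowLen_partA, rowLen_partB]
      | 2 => simp [Finset.sum_range_succ, rowLen_partA, rowLen_partB]; omega
      -- From row index 2 on, the parts of both partitions agree: n-1 at index 2, then 0.
      | j + 3 =>
        rw [Finset.sum_range_succ _ (j + 2), Finset.sum_range_succ _ (j + 2)]
        refine Nat.add_le_add (ih (j + 2) (by omega)) ?_
        cases j <;> simp [rowLen_partA, rowLen_partB]

theorem kostka_partB_le_partA {n : ℕ} (hn : 1 ≤ n) (lam : YoungDiagram) :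
    kostka lam (partB n) ≤ kostka lam (partA n) := by
  refine kostka_le_of_move (r := n) ?_ ?_ ?_ ?_ ?_ lam
  · simp [rowLen_partB]
  · simp [rowLen_partB]
  · simp [rowLen_partA]
  · simp [rowLen_partA, rowLen_partB]; omega
  · intro i hi
    obtain ⟨j, rfl⟩ := Nat.exists_eq_add_of_le hi
    rw [add_comm]
    cases j <;> simp [rowLen_partA, rowLen_partB]

/-! ### Maximum independent sets through the attachment vertex -/

/-- Replaces modular subtraction by linear conditions on positions, so that later adjacency
questions reduce to `omega`. -/
theorem cycleGraph_adj_iff {m : ℕ} (hm : 3 ≤ m) (i j : Fin m) :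
    (SimpleGraph.cycleGraph m).Adj i j ↔
      i.val + 1 = j.val ∨ j.val + 1 = i.val ∨ (i.val = 0 ∧ j.val + 1 = m) ∨
        (j.val = 0 ∧ i.val + 1 = m) := by
  have hsub : ∀ a b : Fin m, (a - b).val = 1 ↔
      b.val + 1 = a.val ∨ (a.val = 0 ∧ b.val + 1 = m) := by
    intro a b
    rw [Fin.val_sub]
    have ha := a.2
    have hb := b.2
    rcases Nat.lt_or_ge (m - b.val + a.val) m with h | h
    · rw [Nat.mod_eq_of_lt h]; omega
    · rw [Nat.mod_eq_sub_mod h, Nat.mod_eq_of_lt (by omega)]; omega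
  rw [SimpleGraph.cycleGraph_adj', hsub, hsub]
  omega

theorem colorWeight_apply {V : Type*} [Fintype V] (κ : V → ℕ) (j : ℕ) :
    colorWeight κ j = (Finset.univ.filter fun v => κ v = j).card := by
  simp [colorWeight, Finsupp.finsetSum_apply, Finsupp.single_apply, Finset.sum_boole]

/-- A maximum independent set of the squid graph on an odd cycle through the vertex of attachment;
`t` is the position of the only pair of consecutive cycle vertices outside of the set. -/
def centerClass (m k t : ℕ) : Finset (Fin m ⊕ Fin k) :=
  (Finset.univ.filter fun i : Fin m =>
    i.val % 2 = 0 ∧ i.val ≤ 2 * t ∨ i.val % 2 = 1 ∧ 2 * t + 2 < i.val).map Function.Embedding.inl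

@[simp] theorem inl_mem_centerClass {m k t : ℕ} {i : Fin m} :
    Sum.inl i ∈ centerClass m k t ↔
      i.val % 2 = 0 ∧ i.val ≤ 2 * t ∨ i.val % 2 = 1 ∧ 2 * t + 2 < i.val := by
  simp [centerClass]

@[simp] theorem inr_notMem_centerClass {m k t : ℕ} {i : Fin k} :
    Sum.inr i ∉ centerClass m k t := by
  simp [centerClass]

/-- The class takes exactly one vertex from each pair {2j, 2j+1} with j < n-1, the even one when j ≤
t and the odd one afterwards; the unpaired vertex 2n-2 is left out. -/
theorem card_centerClass {n m k t : ℕ} (hm : m + 1 = 2 * n) (ht : t + 1 < n) :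
    (centerClass m k t).card = n - 1 := by
  rw [← Finset.card_range (n - 1)]
  refine Finset.card_bij' (fun v _ => Sum.elim (fun i : Fin m => i.val / 2) (fun _ => 0) v)
    (fun j hj => Sum.inl ⟨if j ≤ t then 2 * j else 2 * j + 1, by
      rw [Finset.mem_range] at hj; split_ifs <;> omega⟩) ?_ ?_ ?_ ?_
  · rintro (i | i) h
    · have := i.2
      rw [inl_mem_centerClass] at h
      simp only [Sum.elim_inl, Finset.mem_range]
      omega
    · simp at h
  · intro j hj
    rw [inl_mem_centerClass]
    dsimp only
    split_ifs <;> omega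
  · rintro (i | i) h
    · rw [inl_mem_centerClass] at h
      simp only [Sum.elim_inl, Sum.inl.injEq]
      apply Fin.ext
      show (if i.val / 2 ≤ t then 2 * (i.val / 2) else 2 * (i.val / 2) + 1) = i.val
      split_ifs <;> omega
    · simp at h
  · intro j hj
    simp only [Sum.elim_inl]
    split_ifs <;> omega

/-- The two endpoints of the edge of the cycle missed by `centerClass`. -/
def gapVertex {m k t : ℕ} (h : 2 * t + 2 < m) (b : Bool) : Fin m ⊕ Fin k :=
  Sum.inl ⟨if b then 2 * t + 1 else 2 * t + 2, by split_ifs <;> omega⟩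

theorem gapVertex_notMem {m k t : ℕ} (h : 2 * t + 2 < m) (b : Bool) :
    (gapVertex h b : Fin m ⊕ Fin k) ∉ centerClass m k t := by
  rw [gapVertex, inl_mem_centerClass]
  dsimp only
  split_ifs <;> omega

theorem gapVertex_ne {m k t : ℕ} (h : 2 * t + 2 < m) (b : Bool) :
    (gapVertex h b : Fin m ⊕ Fin k) ≠ gapVertex h (!b) := by
  cases b <;> simp [gapVertex]

theorem squidGraph_adj_gapVertex {m k t : ℕ} (h : 2 * t + 2 < m) (b : Bool) :
    (squidGraph m k).Adj (gapVertex h b) (gapVertex h (!b)) := by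
  show (SimpleGraph.cycleGraph m).Adj _ _
  rw [cycleGraph_adj_iff (by omega)]
  cases b <;> simp

/-- Membership alternates around the cycle except across the gap, including the closing edge from
2n-2 (outside) to 0 (inside). Leaves lie outside and their only neighbor, 0, inside. Hence the
complement of the class spans no edge but the gap. -/
theorem squidGraph_adj_cases {n m k t : ℕ} (hm : m + 1 = 2 * n) (ht : t + 1 < n)
    (h : 2 * t + 2 < m) {v w : Fin m ⊕ Fin k} (hvw : (squidGraph m k).Adj v w) :
    (v ∈ centerClass m k t ↔ w ∉ centerClass m k t) ∨
      ∃ b, v = gapVertex h b ∧ w = gapVertex h (!b) := by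
  rcases v with i | i <;> rcases w with j | j
  · replace hvw : (SimpleGraph.cycleGraph m).Adj i j := hvw
    rw [cycleGraph_adj_iff (by omega)] at hvw
    by_cases h1 : i.val = 2 * t + 1 ∧ j.val = 2 * t + 2
    · exact Or.inr ⟨true, by simp [gapVertex, ← h1.1], by simp [gapVertex, ← h1.2]⟩
    by_cases h2 : j.val = 2 * t + 1 ∧ i.val = 2 * t + 2
    · exact Or.inr ⟨false, by simp [gapVertex, ← h2.2], by simp [gapVertex, ← h2.1]⟩
    left
    have := i.2
    have := j.2
    rw [inl_mem_centerClass, inl_mem_centerClass]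
    omega
  · replace hvw : i.val = 0 := hvw
    simp [hvw]
  · replace hvw : j.val = 0 := hvw
    simp [hvw]
  · exact hvw.elim

section ColorClass

variable {n m k : ℕ} (κ : (squidGraph m k).Coloring ℕ)

/-- Two vertices with the same half form a pair {2j, 2j+1}, which is an edge. -/
theorem half_injOn_colorClass (hm : m + 1 = 2 * n) (h0 : 3 ≤ m) {c : ℕ} :
    Set.InjOn (fun i : Fin m => i.val / 2)
      (Finset.univ.filter fun i : Fin m => κ (Sum.inl i) = c : Finset (Fin m)) := by
  intro i hi j hj hij
  simp only [Finset.coe_filter, Finset.mem_univ, true_and, Set.mem_ofPred_eq] at hi hj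
  dsimp only at hij
  by_contra hne
  have hne' : i.val ≠ j.val := fun h => hne (Fin.ext h)
  have : (squidGraph m k).Adj (Sum.inl i) (Sum.inl j) := by
    show (SimpleGraph.cycleGraph m).Adj _ _
    rw [cycleGraph_adj_iff h0]
    omega
  exact κ.valid this (hi.trans hj.symm)

/-- The only vertex whose half is not below n-1 is 2n-2, a neighbor of 0. -/
theorem half_mem_range (hm : m + 1 = 2 * n) (h0 : 3 ≤ m) {i : Fin m}
    (hi : κ (Sum.inl i) = κ (Sum.inl ⟨0, by omega⟩)) : i.val / 2 ∈ Finset.range (n - 1) := by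
  rw [Finset.mem_range]
  by_contra h
  have hi2 := i.2
  have : (squidGraph m k).Adj (Sum.inl i) (Sum.inl ⟨0, by omega⟩) := by
    show (SimpleGraph.cycleGraph m).Adj _ _
    rw [cycleGraph_adj_iff h0]
    dsimp only
    omega
  exact κ.valid this hi

theorem card_center_color (h0 : 3 ≤ m) :
    (Finset.univ.filter fun v => κ v = κ (Sum.inl ⟨0, by omega⟩)).card =
      (Finset.univ.filter fun i : Fin m => κ (Sum.inl i) = κ (Sum.inl ⟨0, by omega⟩)).card := by
  refine Eq.trans (congrArg Finset.card ?_) (Finset.card_map Function.Embedding.inl)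
  ext v
  rcases v with i | i
  · simp
  · have : κ (Sum.inr i) ≠ κ (Sum.inl ⟨0, by omega⟩) := κ.valid (show _ = 0 from rfl)
    simp [this]

theorem colorWeight_center_le (hm : m + 1 = 2 * n) (h0 : 3 ≤ m) :
    colorWeight κ (κ (Sum.inl ⟨0, by omega⟩)) ≤ n - 1 := by
  rw [colorWeight_apply, card_center_color κ h0, ← Finset.card_range (n - 1)]
  refine Finset.card_le_card_of_injOn (fun i : Fin m => i.val / 2) ?_
    (half_injOn_colorClass κ hm h0)
  intro i hi
  exact half_mem_range κ hm h0 (by simpa using hi)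

/-- In the case of equality, the injection of the class into the n-1 pairs is onto. -/
theorem exists_half_of_card (hm : m + 1 = 2 * n) (h0 : 3 ≤ m)
    (hc : colorWeight κ (κ (Sum.inl ⟨0, by omega⟩)) = n - 1) {j : ℕ} (hj : j < n - 1) :
    ∃ i : Fin m, κ (Sum.inl i) = κ (Sum.inl ⟨0, by omega⟩) ∧ i.val / 2 = j := by
  rw [colorWeight_apply, card_center_color κ h0] at hc
  have := Finset.surj_on_of_inj_on_of_card_le (s := Finset.univ.filter fun i : Fin m =>
      κ (Sum.inl i) = κ (Sum.inl ⟨0, by omega⟩)) (t := Finset.range (n - 1))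
    (fun i _ => i.val / 2) (fun i hi => half_mem_range κ hm h0 (by simpa using hi))
    (fun i j hi hj h => half_injOn_colorClass κ hm h0 (by simpa using hi) (by simpa using hj) h)
    (by simp [hc]) j (Finset.mem_range.2 hj)
  obtain ⟨i, hi, rfl⟩ := this
  exact ⟨i, by simpa using hi, rfl⟩

/-- A class of maximum size picks one vertex from each pair {2j, 2j+1}. Once it picks the odd vertex
2j+1 it cannot pick 2j+2, so the choice passes from even to odd at most once. It starts even, with
vertex 0, and `t` is the last pair where it is even. -/
theorem exists_centerClass (hm : m + 1 = 2 * n) (h0 : 3 ≤ m)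
    (hc : colorWeight κ (κ (Sum.inl ⟨0, by omega⟩)) = n - 1) :
    ∃ t, t + 1 < n ∧ ∀ v, κ v = κ (Sum.inl ⟨0, by omega⟩) ↔ v ∈ centerClass m k t := by
  classical
  set c := κ (Sum.inl ⟨0, by omega⟩) with hcdef
  have hval : ∀ i j : Fin m, (squidGraph m k).Adj (Sum.inl i) (Sum.inl j) →
      κ (Sum.inl i) = c → κ (Sum.inl j) ≠ c := fun i j h hi hj => κ.valid h (hi.trans hj.symm)
  have hadj : ∀ i j : Fin m, i.val + 1 = j.val →
      (squidGraph m k).Adj (Sum.inl i) (Sum.inl j) := fun i j h => by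
    show (SimpleGraph.cycleGraph m).Adj _ _
    rw [cycleGraph_adj_iff h0]
    exact Or.inl h
  -- `P j` says that the even vertex of the pair `j` is picked; below, it is shown to be an initial
  -- segment.
  let P : ℕ → Prop := fun j => ∃ i : Fin m, i.val = 2 * j ∧ κ (Sum.inl i) = c
  have hP0 : P 0 := ⟨⟨0, by omega⟩, rfl, rfl⟩
  have hodd : ∀ j < n - 1, ¬ P j → ∃ i : Fin m, i.val = 2 * j + 1 ∧ κ (Sum.inl i) = c := by
    intro j hj hP
    obtain ⟨i, hi, rfl⟩ := exists_half_of_card κ hm h0 hc hj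
    refine ⟨i, ?_, hi⟩
    by_contra h
    exact hP ⟨i, by omega, hi⟩
  have hstep : ∀ j, P (j + 1) → P j := by
    rintro j ⟨i, hi, hic⟩
    by_contra hP
    have hjn : j < n - 1 := by have := i.2; omega
    obtain ⟨i', hi', hic'⟩ := hodd j hjn hP
    exact hval i' i (hadj _ _ (by omega)) hic' hic
  have hanti : ∀ i j, i ≤ j → P j → P i := by
    intro i j hij
    induction hij with
    | refl => exact id
    | step _ ih => exact fun h => ih (hstep _ h)
  have hPn : ∀ j, P j → j < n - 1 := by
    rintro j ⟨i, hi, hic⟩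
    have := half_mem_range κ hm h0 hic
    rw [Finset.mem_range] at this
    omega
  set t := Nat.findGreatest P (n - 2) with ht
  have hPt : P t := Nat.findGreatest_spec (Nat.zero_le _) hP0
  have hiff : ∀ j, P j ↔ j ≤ t := fun j =>
    ⟨fun h => Nat.le_findGreatest (by have := hPn j h; omega) h, fun h => hanti _ _ h hPt⟩
  have htn := hPn t hPt
  refine ⟨t, by omega, ?_⟩
  rintro (i | i)
  · rw [inl_mem_centerClass]
    rcases Nat.mod_two_eq_zero_or_one i.val with h | h
    · have h1 : κ (Sum.inl i) = c ↔ P (i.val / 2) := by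
        refine ⟨fun hi => ⟨i, by omega, hi⟩, ?_⟩
        rintro ⟨i', hi', hic⟩
        obtain rfl : i' = i := Fin.ext (by omega)
        exact hic
      rw [h1, hiff]
      omega
    · have h1 : κ (Sum.inl i) = c ↔ ¬ P (i.val / 2) := by
        constructor
        · rintro hi ⟨i', hi', hic⟩
          exact hval i' i (hadj _ _ (by omega)) hic hi
        · intro hP
          obtain ⟨i', hi', hic⟩ := hodd (i.val / 2) (by have := i.2; omega) hP
          obtain rfl : i' = i := Fin.ext (by omega)
          exact hic
      rw [h1, hiff]
      omega
  · have : κ (Sum.inr i) ≠ c := κ.valid (show _ = 0 from rfl)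
    simp [this]

end ColorClass

/-! ### Counting the colorings with a given class of the attachment vertex -/

/-- The vertices outside of `centerClass` and of the edge it misses. -/
def freeVerts {m t : ℕ} (k : ℕ) (h : 2 * t + 2 < m) : Finset (Fin m ⊕ Fin k) :=
  ((centerClass m k t)ᶜ.erase (gapVertex h true)).erase (gapVertex h false)

theorem mem_freeVerts {m k t : ℕ} {h : 2 * t + 2 < m} {v : Fin m ⊕ Fin k} :
    v ∈ freeVerts k h ↔ v ∉ centerClass m k t ∧ ∀ b, v ≠ gapVertex h b := by
  simp only [freeVerts, Finset.mem_erase, Finset.mem_compl, Bool.forall_bool]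
  tauto

theorem card_freeVerts {n m k t : ℕ} (hm : m + 1 = 2 * n) (ht : t + 1 < n)
    (h : 2 * t + 2 < m) : (freeVerts k h).card = n + k - 2 := by
  rw [freeVerts, Finset.card_erase_of_mem, Finset.card_erase_of_mem, Finset.card_compl,
    card_centerClass hm ht]
  · simp only [Fintype.card_sum, Fintype.card_fin]
    omega
  · rw [Finset.mem_compl]
    exact gapVertex_notMem h true
  · rw [Finset.mem_erase, Finset.mem_compl]
    exact ⟨gapVertex_ne h false, gapVertex_notMem h false⟩

theorem card_three_colors {V : Type*} [Fintype V] (κ : V → ℕ) {c x y : ℕ} (hcx : c ≠ x)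
    (hcy : c ≠ y) (hxy : x ≠ y) (hκ : ∀ v, κ v = c ∨ κ v = x ∨ κ v = y) :
    colorWeight κ c + (colorWeight κ x + colorWeight κ y) = Fintype.card V := by
  simp only [colorWeight_apply]
  have h := Finset.card_eq_sum_card_fiberwise (f := κ) (s := Finset.univ) (t := {c, x, y})
    fun v _ => by simpa using hκ v
  rw [Finset.sum_insert (by simp [hcx, hcy]), Finset.sum_pair hxy] at h
  rw [← Finset.card_univ, h]

/-- The coloring with color `c` on `C`, color `x` on `S` and color `y` elsewhere. -/
def threeColoring {V : Type*} [DecidableEq V] (C S : Finset V) (c x y : ℕ) (v : V) : ℕ :=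
  if v ∈ C then c else if v ∈ S then x else y

section Count

variable {n m k : ℕ} {c x y : ℕ}

theorem threeColoring_eq_left {V : Type*} [DecidableEq V] {C S : Finset V} (hcx : c ≠ x)
    (hcy : c ≠ y) {v : V} : threeColoring C S c x y v = c ↔ v ∈ C := by
  unfold threeColoring
  split_ifs <;> simp_all [Ne.symm]

theorem threeColoring_eq_mid {V : Type*} [DecidableEq V] {C S : Finset V} (hcx : c ≠ x)
    (hxy : x ≠ y) (hS : Disjoint C S) {v : V} : threeColoring C S c x y v = x ↔ v ∈ S := by
  unfold threeColoring
  have : v ∈ C → v ∉ S := fun h => Finset.disjoint_left.1 hS h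
  split_ifs <;> simp_all [Ne.symm]

/-- Only the sizes of `C` and `S` have to be checked; the multiplicity of the third color follows
from the total number of vertices. -/
theorem colorWeight_threeColoring {V : Type*} [Fintype V] [DecidableEq V] {C S : Finset V}
    (hcx : c ≠ x) (hcy : c ≠ y) (hxy : x ≠ y) (hS : Disjoint C S) {a : ℕ →₀ ℕ}
    (hc : a c = C.card) (hx : a x = S.card) (hy : a c + (a x + a y) = Fintype.card V)
    (hz : ∀ j, j ≠ c → j ≠ x → j ≠ y → a j = 0) :
    colorWeight (threeColoring C S c x y) = a := by
  have hval : ∀ v, threeColoring C S c x y v = c ∨ threeColoring C S c x y v = x ∨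
      threeColoring C S c x y v = y := fun v => by
    unfold threeColoring
    split_ifs <;> simp
  have h1 : colorWeight (threeColoring C S c x y) c = a c := by
    rw [colorWeight_apply, hc]
    congr 1
    ext v
    simp [threeColoring_eq_left hcx hcy]
  have h2 : colorWeight (threeColoring C S c x y) x = a x := by
    rw [colorWeight_apply, hx]
    congr 1
    ext v
    simp [threeColoring_eq_mid hcx hxy hS]
  have h3 := card_three_colors (threeColoring C S c x y) hcx hcy hxy hval
  ext j
  by_cases e1 : j = c
  · rw [e1, h1]
  by_cases e2 : j = x
  · rw [e2, h2]
  by_cases e3 : j = y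
  · rw [e3]; omega
  rw [hz j e1 e2 e3, colorWeight_apply, Finset.card_eq_zero, Finset.filter_eq_empty_iff]
  intro v _ hv
  rcases hval v with h | h | h <;> omega

theorem disjoint_centerClass {t : ℕ} (h : 2 * t + 2 < m) (b : Bool) {S : Finset (Fin m ⊕ Fin k)}
    (hS : S ⊆ freeVerts k h) : Disjoint (centerClass m k t) (insert (gapVertex h b) S) := by
  rw [Finset.disjoint_right]
  intro v hv
  rcases Finset.mem_insert.1 hv with rfl | hv
  · exact gapVertex_notMem h b
  · exact (mem_freeVerts.1 (hS hv)).1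

theorem gapVertex_notMem_of_subset {t : ℕ} (h : 2 * t + 2 < m) (b : Bool)
    {S : Finset (Fin m ⊕ Fin k)} (hS : S ⊆ freeVerts k h) : gapVertex h b ∉ S :=
  fun hv => (mem_freeVerts.1 (hS hv)).2 b rfl

/-- An edge other than the gap has exactly one endpoint of color `c`. On the gap exactly one
endpoint has color `x`, since `S` avoids both of them. -/
theorem threeColoring_valid (hm : m + 1 = 2 * n) {t : ℕ} (ht : t + 1 < n) (h : 2 * t + 2 < m)
    (hcx : c ≠ x) (hcy : c ≠ y) (hxy : x ≠ y) (b : Bool) {S : Finset (Fin m ⊕ Fin k)}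
    (hS : S ⊆ freeVerts k h) {v w : Fin m ⊕ Fin k} (hvw : (squidGraph m k).Adj v w) :
    threeColoring (centerClass m k t) (insert (gapVertex h b) S) c x y v ≠
      threeColoring (centerClass m k t) (insert (gapVertex h b) S) c x y w := by
  intro heq
  rcases squidGraph_adj_cases hm ht h hvw with h1 | ⟨b', rfl, rfl⟩
  · rw [← threeColoring_eq_left (S := insert (gapVertex h b) S) hcx hcy,
      ← threeColoring_eq_left (v := w) (S := insert (gapVertex h b) S) hcx hcy, heq] at h1
    exact iff_not_self h1
  · have h2 : ∀ b', threeColoring (centerClass m k t) (insert (gapVertex h b) S) c x y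
        (gapVertex h b') = x ↔ b' = b := by
      intro b'
      rw [threeColoring_eq_mid hcx hxy (disjoint_centerClass h b hS), Finset.mem_insert,
        or_iff_left (gapVertex_notMem_of_subset h b' hS)]
      refine ⟨fun e => ?_, fun e => by rw [e]⟩
      by_contra hb
      have : b = !b' := by cases b <;> cases b' <;> simp_all
      rw [this] at e
      exact gapVertex_ne h b' e
    have h3 := h2 b'
    rw [heq, h2] at h3
    cases b' <;> cases b <;> simp_all

/-- The data describing a coloring of the squid graph whose color class of the vertex of attachment
is of maximum size: the pair of consecutive cycle vertices outside of this class, the choice of one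
of them, and the other vertices of its color. -/
abbrev ColoringData (n m k p : ℕ) (hm : m + 1 = 2 * n) : Type :=
  (t : Fin (n - 1)) × Bool ×
    {S // S ∈ (freeVerts k (show 2 * t.val + 2 < m by have := t.2; omega)).powersetCard p}

theorem card_coloringData (p : ℕ) (hm : m + 1 = 2 * n) :
    Nat.card (ColoringData n m k p hm) = 2 * (n - 1) * (n + k - 2).choose p := by
  rw [Nat.card_sigma, Finset.sum_const_nat (m := 2 * (n + k - 2).choose p)]
  · rw [Finset.card_univ, Fintype.card_fin]
    ring
  · intro t _
    rw [Nat.card_prod, Nat.card_eq_fintype_card (α := Bool), Fintype.card_bool,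
      Nat.card_eq_fintype_card, Fintype.card_coe, Finset.card_powersetCard,
      card_freeVerts hm (by have := t.2; omega)]

/-- These colorings are in bijection with `ColoringData`. The part at `x` is `p + 1` because one
vertex of color `x` is an endpoint of the gap and the other `p` are free vertices. -/
theorem card_colorings_of_center (hm : m + 1 = 2 * n) (h0 : 3 ≤ m) (hcx : c ≠ x) (hcy : c ≠ y)
    (hxy : x ≠ y) {p : ℕ} {a : ℕ →₀ ℕ} (hc : a c = n - 1) (hx : a x = p + 1)
    (hy : a c + (a x + a y) = m + k) (hz : ∀ j, j ≠ c → j ≠ x → j ≠ y → a j = 0) :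
    Nat.card {κ : (squidGraph m k).Coloring ℕ //
      colorWeight κ = a ∧ κ (Sum.inl ⟨0, by omega⟩) = c} =
      2 * (n - 1) * (n + k - 2).choose p := by
  rw [← card_coloringData p hm]
  symm
  refine Nat.card_congr (Equiv.ofBijective (fun d => ⟨SimpleGraph.Coloring.mk
    (threeColoring (centerClass m k d.1) (insert (gapVertex _ d.2.1) d.2.2.1) c x y)
    (fun hvw => threeColoring_valid hm (by have := d.1.2; omega) _ hcx hcy hxy _
      (Finset.mem_powersetCard.1 d.2.2.2).1 hvw), ?_, ?_⟩) ⟨?_, ?_⟩)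
  · have hS := Finset.mem_powersetCard.1 d.2.2.2
    refine colorWeight_threeColoring hcx hcy hxy (disjoint_centerClass _ _ hS.1) ?_ ?_ ?_ hz
    · rw [hc, card_centerClass hm (by have := d.1.2; omega)]
    · rw [hx, Finset.card_insert_of_notMem (gapVertex_notMem_of_subset _ _ hS.1), hS.2]
    · simpa using hy
  · refine (threeColoring_eq_left hcx hcy).2 ?_
    simp
  · rintro ⟨t, b, S, hS⟩ ⟨t', b', S', hS'⟩ heq
    have hS := (Finset.mem_powersetCard.1 hS).1
    have hS' := (Finset.mem_powersetCard.1 hS').1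
    have hfun : ∀ v, threeColoring (centerClass m k t) (insert (gapVertex _ b) S) c x y v =
        threeColoring (centerClass m k t') (insert (gapVertex _ b') S') c x y v := fun v =>
      congrArg (fun κ : {κ : (squidGraph m k).Coloring ℕ //
        colorWeight κ = a ∧ κ (Sum.inl ⟨0, by omega⟩) = c} => κ.1 v) heq
    have hC : ∀ v, v ∈ centerClass m k t ↔ v ∈ centerClass m k t' := fun v => by
      rw [← threeColoring_eq_left hcx hcy, hfun, threeColoring_eq_left hcx hcy]
    have ht := t.2
    have ht' := t'.2
    have htt : t = t' := by
      -- The vertex 2t+2 is outside the class of `t`, but would be inside that of `t'` if t < t'.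
      -- The symmetric test excludes t' < t.
      have h1 := hC (Sum.inl ⟨2 * t.val + 2, by omega⟩)
      have h2 := hC (Sum.inl ⟨2 * t'.val + 2, by omega⟩)
      rw [inl_mem_centerClass, inl_mem_centerClass] at h1 h2
      apply Fin.ext
      dsimp only at h1 h2
      omega
    subst htt
    have hg : 2 * t.val + 2 < m := by omega
    have hins : ∀ v, v ∈ insert (gapVertex hg b) S ↔
        v ∈ insert (gapVertex hg b') S' := fun v => by
      rw [← threeColoring_eq_mid hcx hxy (disjoint_centerClass _ b hS), hfun,
        threeColoring_eq_mid hcx hxy (disjoint_centerClass _ b' hS')]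
    have hbb : b = b' := by
      have h1 := (hins (gapVertex hg b)).1 (Finset.mem_insert_self _ _)
      rw [Finset.mem_insert, or_iff_left (gapVertex_notMem_of_subset _ b hS')] at h1
      by_contra hb
      have : b' = !b := by cases b <;> cases b' <;> simp_all
      rw [this] at h1
      exact gapVertex_ne _ b h1
    subst hbb
    have : S = S' := by
      rw [← Finset.erase_insert (gapVertex_notMem_of_subset _ b hS), Finset.ext hins,
        Finset.erase_insert (gapVertex_notMem_of_subset _ b hS')]
    subst this
    rfl
  · rintro ⟨κ, hκ, hκc⟩
    obtain ⟨t, ht, hC⟩ := exists_centerClass κ hm h0 (by rw [hκ, hκc, hc])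
    rw [hκc] at hC
    have hval : ∀ v, κ v = c ∨ κ v = x ∨ κ v = y := by
      intro v
      by_contra hne
      push Not at hne
      have h1 := hz (κ v) hne.1 hne.2.1 hne.2.2
      rw [← hκ, colorWeight_apply, Finset.card_eq_zero, Finset.filter_eq_empty_iff] at h1
      exact h1 (Finset.mem_univ v) rfl
    have hgap : 2 * t + 2 < m := by omega
    have hnc : ∀ b, κ (gapVertex hgap b) ≠ c := fun b h =>
      gapVertex_notMem hgap b ((hC _).1 h)
    -- The gap endpoints are adjacent and avoid `c`, so they cannot both have color `y`.
    obtain ⟨b, hb⟩ : ∃ b, κ (gapVertex hgap b) = x := by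
      by_contra hb
      push Not at hb
      have h1 := κ.valid (squidGraph_adj_gapVertex hgap true)
      have h2 := hval (gapVertex hgap true)
      have h3 := hval (gapVertex hgap false)
      have h4 := hnc true
      have h5 := hnc false
      have h6 := hb true
      have h7 := hb false
      rw [Bool.not_true] at h1
      omega
    have hb' : κ (gapVertex hgap (!b)) ≠ x := fun h =>
      κ.valid (squidGraph_adj_gapVertex hgap b) (hb.trans h.symm)
    set S := (Finset.univ.filter fun v => κ v = x).erase (gapVertex hgap b) with hS
    have hbmem : gapVertex hgap b ∈ Finset.univ.filter fun v => κ v = x := by simpa using hb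
    have hins : insert (gapVertex hgap b) S = Finset.univ.filter fun v => κ v = x :=
      Finset.insert_erase hbmem
    have hSmem : S ∈ (freeVerts k hgap).powersetCard p := by
      rw [Finset.mem_powersetCard]
      constructor
      · intro v hv
        rw [hS, Finset.mem_erase, Finset.mem_filter] at hv
        obtain ⟨hv1, -, hv2⟩ := hv
        refine mem_freeVerts.2 ⟨fun h => ?_, fun b' e => ?_⟩
        · exact hcx (((hC v).2 h).symm.trans hv2)
        · by_cases hbb : b' = b
          · exact hv1 (hbb ▸ e)
          · have : b' = !b := by cases b <;> cases b' <;> simp_all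
            rw [this] at e
            exact hb' (e ▸ hv2)
      · rw [hS, Finset.card_erase_of_mem hbmem, ← colorWeight_apply, hκ, hx]
        rfl
    refine ⟨⟨⟨t, by omega⟩, b, S, hSmem⟩, Subtype.ext (RelHom.ext fun v => ?_)⟩
    show threeColoring (centerClass m k t) (insert (gapVertex hgap b) S) c x y v = κ v
    rw [hins]
    unfold threeColoring
    simp only [← hC, Finset.mem_filter, Finset.mem_univ, true_and]
    rcases hval v with h | h | h <;> split_ifs <;> omega

/-- All colors used lie in the finite support of `a`. Finiteness matters because `Nat.card` is 0 on
infinite types and would not be additive. -/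
theorem finite_colorings {V : Type*} [Fintype V] (G : SimpleGraph V) (a : ℕ →₀ ℕ) :
    Finite {κ : G.Coloring ℕ // colorWeight κ = a} := by
  have hb : ∀ (κ : {κ : G.Coloring ℕ // colorWeight κ = a}) (v : V), κ.1 v ∈ a.support := by
    rintro ⟨κ, rfl⟩ v
    rw [Finsupp.mem_support_iff, colorWeight_apply, Finset.card_ne_zero]
    exact ⟨v, by simp⟩
  refine Finite.of_injective (fun κ v => (⟨κ.1 v, hb κ v⟩ : a.support)) ?_
  intro κ κ' h
  refine Subtype.ext (RelHom.ext fun v => ?_)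
  exact congrArg Subtype.val (congrFun h v)

theorem card_colorings_eq_sum {V : Type*} [Fintype V] (G : SimpleGraph V) (a : ℕ →₀ ℕ) (v : V)
    (T : Finset ℕ) (hT : ∀ κ : G.Coloring ℕ, colorWeight κ = a → κ v ∈ T) :
    Nat.card {κ : G.Coloring ℕ // colorWeight κ = a} =
      ∑ c ∈ T, Nat.card {κ : G.Coloring ℕ // colorWeight κ = a ∧ κ v = c} := by
  have := finite_colorings G a
  have hfin : ∀ c, Finite {κ : G.Coloring ℕ // colorWeight κ = a ∧ κ v = c} := fun c =>
    Finite.of_injective (fun κ => (⟨κ.1, κ.2.1⟩ : {κ : G.Coloring ℕ // colorWeight κ = a}))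
      fun κ κ' h => Subtype.ext (congrArg (fun κ => κ.1) h)
  rw [← Finset.sum_coe_sort T, ← Nat.card_sigma]
  exact Nat.card_congr
    { toFun := fun κ => ⟨⟨κ.1 v, hT κ.1 κ.2⟩, κ.1, κ.2, rfl⟩
      invFun := fun κ => ⟨κ.2.1, κ.2.2.1⟩
      left_inv := fun κ => rfl
      right_inv := by
        rintro ⟨⟨c, hc⟩, κ, h1, h2⟩
        have h3 : κ v = c := h2
        subst h3
        rfl }

end Count

/-! ### The two coefficients and their comparison -/

theorem mCoeff_chromaticSymm {V : Type*} [Fintype V] (G : SimpleGraph V) (lam : YoungDiagram) :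
    mCoeff lam (chromaticSymm G) = Nat.card {κ : G.Coloring ℕ // colorWeight κ = expo lam} :=
  mCoeff_eq_coeff _ _

theorem mCoeff_partA_squid {n : ℕ} (hn : 2 ≤ n) :
    mCoeff (partA n) (chromaticSymm (squidGraph (2 * n - 1) n)) =
      ((2 * (n - 1) * Nat.choose (2 * n - 2) (n - 1) : ℕ) : ℚ) := by
  have hm : 2 * n - 1 + 1 = 2 * n := by omega
  have h0 : 3 ≤ 2 * n - 1 := by omega
  -- The attachment vertex has a color of multiplicity at most n-1, which forces color 2. Color 0
  -- has multiplicity n, so `p = n - 1`.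
  rw [mCoeff_chromaticSymm, card_colorings_eq_sum _ _ (Sum.inl ⟨0, by omega⟩) {2},
    Finset.sum_singleton, card_colorings_of_center (x := 0) (y := 1) (p := n - 1) hm h0]
  · congr 3; omega
  any_goals simp [rowLen_partA]
  · omega
  · omega
  · intro j h1 h2 h3
    match j with
    | j + 3 => simp
  · intro κ hκ
    have h := colorWeight_center_le κ hm h0
    have h1 : colorWeight κ (κ (Sum.inl ⟨0, by omega⟩)) ≠ 0 := by
      rw [colorWeight_apply, Finset.card_ne_zero]
      exact ⟨Sum.inl ⟨0, by omega⟩, by simp⟩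
    rw [hκ, expo_apply, rowLen_partA] at h h1
    generalize κ (Sum.inl ⟨0, by omega⟩) = j at h h1
    match j with
    | 0 => simp at h; omega
    | 1 => simp at h; omega
    | 2 => rfl
    | j + 3 => simp at h1

theorem mCoeff_partB_squid {n : ℕ} (hn : 2 ≤ n) :
    mCoeff (partB n) (chromaticSymm (squidGraph (2 * n - 1) n)) =
      ((4 * (n - 1) * Nat.choose (2 * n - 2) n : ℕ) : ℚ) := by
  have hm : 2 * n - 1 + 1 = 2 * n := by omega
  have h0 : 3 ≤ 2 * n - 1 := by omega
  -- Both colors 1 and 2 have multiplicity n-1 and are possible at the attachment vertex. In either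
  -- case color 0, of multiplicity n+1, gives `p = n`; the two equal counts turn the factor 2 into
  -- 4.
  rw [mCoeff_chromaticSymm, card_colorings_eq_sum _ _ (Sum.inl ⟨0, by omega⟩) {1, 2},
    Finset.sum_pair (by decide),
    card_colorings_of_center (x := 0) (y := 2) (p := n) hm h0,
    card_colorings_of_center (x := 0) (y := 1) (p := n) hm h0]
  · rw [show n + n - 2 = 2 * n - 2 by omega]
    congr 1; ring
  any_goals simp [rowLen_partB]
  · omega
  · intro j h1 h2 h3
    match j with
    | j + 3 => simp
  · omega
  · intro j h1 h2 h3
    match j with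
    | j + 3 => simp
  · intro κ hκ
    have h := colorWeight_center_le κ hm h0
    have h1 : colorWeight κ (κ (Sum.inl ⟨0, by omega⟩)) ≠ 0 := by
      rw [colorWeight_apply, Finset.card_ne_zero]
      exact ⟨Sum.inl ⟨0, by omega⟩, by simp⟩
    rw [hκ, expo_apply, rowLen_partB] at h h1
    generalize κ (Sum.inl ⟨0, by omega⟩) = j at h h1
    match j with
    | 0 => simp at h; omega
    | 1 => simp
    | 2 => simp
    | j + 3 => simp at h1

/-- With r = n-1, the identity (r+1) C(2r, r+1) = r C(2r, r) reduces the claim to r+1 < 2r, that is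
n ≥ 3; for n = 2 the two sides are equal. -/
theorem choose_inequality {n : ℕ} (hn : 3 ≤ n) :
    2 * (n - 1) * Nat.choose (2 * n - 2) (n - 1) < 4 * (n - 1) * Nat.choose (2 * n - 2) n := by
  obtain ⟨r, rfl⟩ : ∃ r, n = r + 1 := ⟨n - 1, by omega⟩
  have h := Nat.choose_succ_right_eq (2 * r) r
  have hpos := Nat.choose_pos (show r ≤ 2 * r by omega)
  rw [show 2 * r - r = r by omega] at h
  rw [show 2 * (r + 1) - 2 = 2 * r by omega, Nat.add_sub_cancel]
  have h2 : (2 * r).choose r < 2 * (2 * r).choose (r + 1) := by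
    by_contra hcon
    nlinarith
  nlinarith

end SymFun

theorem mainTheorem2 (n : ℕ) (hn : 3 ≤ n) :
    ¬ SymFun.StronglyNice (SymFun.chromaticSymm (SymFun.squidGraph (2 * n - 1) n)) ∧
    SymFun.mCoeff (SymFun.partA n) (SymFun.chromaticSymm (SymFun.squidGraph (2 * n - 1) n)) =
      ((2 * (n - 1) * Nat.choose (2 * n - 2) (n - 1) : ℕ) : ℚ) ∧
    SymFun.mCoeff (SymFun.partB n) (SymFun.chromaticSymm (SymFun.squidGraph (2 * n - 1) n)) =
      ((4 * (n - 1) * Nat.choose (2 * n - 2) n : ℕ) : ℚ) ∧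
    2 * (n - 1) * Nat.choose (2 * n - 2) (n - 1) < 4 * (n - 1) * Nat.choose (2 * n - 2) n ∧
    ¬ SymFun.SchurPositive (SymFun.chromaticSymm (SymFun.squidGraph (2 * n - 1) n)) := by
  have hA := SymFun.mCoeff_partA_squid (n := n) (by omega)
  have hB := SymFun.mCoeff_partB_squid (n := n) (by omega)
  have hlt := SymFun.choose_inequality hn
  have hdom := SymFun.domLE_partA_partB (n := n) (by omega)
  have hAB : SymFun.mCoeff (SymFun.partA n)
        (SymFun.chromaticSymm (SymFun.squidGraph (2 * n - 1) n)) <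
      SymFun.mCoeff (SymFun.partB n) (SymFun.chromaticSymm (SymFun.squidGraph (2 * n - 1) n)) := by
    rw [hA, hB]
    exact_mod_cast hlt
  refine ⟨fun h => (h _ _ hdom).not_gt hAB, hA, hB, hlt, fun h => ?_⟩
  exact (SymFun.mCoeff_le_of_schurPositive hdom.1
    (SymFun.kostka_partB_le_partA (by omega)) h).not_gt hAB
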